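/- Let $m,n\ge 1$ be integers and let $\theta$ be a permutation of $\{1,\dots,m\}\times\{1,\dots,n\}$. Let $\mathbb{F}_\theta^+$ be the unital semigroup generated by $e_1,\dots,e_m,f_1,\dots,f_n$ subject to the relations $e_if_j=f_{j'}e_{i'}$ whenever $\theta(i,j)=(i',j')$, and let $d(w)=(k,l)$ be the degree of a word $w$ with $k$ letters $e$ and $l$ letters $f$. Let $\mathcal{O}_\theta$ be the universal C*-algebra generated by isometries $s_u$ ($u\in\mathbb{F}_\theta^+$) with $s_\varnothing=I$, $s_{uv}=s_us_v$ and $\sum_{i=1}^m s_{e_i}s_{e_i}^*=I=\sum_{j=1}^n s_{f_j}s_{f_j}^*$. For $\mathbf t=(t_1,t_2)\in\mathbb{T}^2$ let $\gamma_{\mathbf t}$ be the gauge automorphism of $\mathcal{O}_\theta$ with $\gamma_{\mathbf t}(s_w)=t_1^kt_2^l s_w$ for $d(w)=(k,l)$; let $\mathfrak{F}=\mathcal{O}_\theta^\gamma$ be its fixed point algebra and $\Phi(X)=\int_{\mathbb{T}^2}\gamma_{\mathbf t}(X)\,d\mathbf t$ the corresponding expectation of $\mathcal{O}_\theta$ onto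 $\mathfrak{F}$ (with respect to normalised Haar measure). For $t\in\mathbb{R}$ let $\sigma_t=\gamma_{(m^{-it},n^{-it})}$, i.e. $\sigma_t(s_us_v^*)=m^{it(k'-k)}n^{it(l'-l)}s_us_v^*$ when $d(u)=(k,l)$ and $d(v)=(k',l')$, and let $\mathcal{O}_\theta^\sigma$ be the fixed point algebra of $\sigma$. A state $\varphi$ on $\mathcal{O}_\theta$ is called a $\sigma$-KMS state if $\varphi(AB)=\varphi(B\sigma_{-i}(A))$ for all $A,B\in\mathcal{O}_\theta$ that are entire for $\sigma$, where $\sigma_z(A)$, $z\in\mathbb{C}$, denotes the entire extension of $t\mapsto\sigma_t(A)$. Suppose that $\mathcal{O}_\theta^\sigma$ has a unique tracial state. Then $\mathfrak{F}$ has a unique tracial state $\tau$, and $\omega=\tau\circ\Phi$ is the unique $\sigma$-KMS state on $\mathcal{O}_\theta$; that is, $\omega$ is a $\sigma$-KMS state, and every $\sigma$-KMS state on $\mathcal{O}_\theta$ equals $\omega$. -/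

import Mathlib

open scoped ENNReal ComplexOrder CStarAlgebra

noncomputable section

/-! ### States, tracial states, fixed points and KMS states -/

section General

variable {A : Type*} [Semiring A] [StarRing A] [Algebra ℂ A] [TopologicalSpace A]

/-- A state: a (continuous) positive linear functional with value `1` at the unit. -/
structure IsState (φ : A →L[ℂ] ℂ) : Prop where
  map_one : φ 1 = 1
  nonneg : ∀ a, 0 ≤ φ (star a * a)

/-- A tracial state. -/
structure IsTracialState (φ : A →L[ℂ] ℂ) : Prop extends IsState φ where
  trace : ∀ a b, φ (a * b) = φ (b * a)

/-- The fixed point algebra of a family of *-automorphisms. -/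
def fixedAlgebra {A : Type*} [Semiring A] [StarRing A] [Algebra ℂ A] [StarModule ℂ A] {G : Type*}
    (α : G → (A ≃⋆ₐ[ℂ] A)) : StarSubalgebra ℂ A where
  carrier := {a | ∀ g, α g a = a}
  mul_mem' ha hb g := by rw [map_mul, ha g, hb g]
  one_mem' g := map_one _
  add_mem' ha hb g := by rw [map_add, ha g, hb g]
  zero_mem' g := map_zero _
  algebraMap_mem' r g := by
    rw [Algebra.algebraMap_eq_smul_one, map_smul, map_one]
  star_mem' ha g := by rw [map_star, ha g]

end General

section KMS

variable {A : Type*} [CStarAlgebra A]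

/-- `F : ℂ → A` is an entire extension of the orbit `t ↦ ϱ_t a`.  Such an `F` is unique if it
exists; its value `F z` is what is denoted by `ϱ_z(a)`. -/
structure IsEntireExtension (ϱ : ℝ → (A ≃⋆ₐ[ℂ] A)) (a : A) (F : ℂ → A) : Prop where
  differentiable : Differentiable ℂ F
  eq_real : ∀ t : ℝ, F t = ϱ t a

/-- `a` is entire for `ϱ`. -/
def IsEntireElement (ϱ : ℝ → (A ≃⋆ₐ[ℂ] A)) (a : A) : Prop :=
  ∃ F : ℂ → A, IsEntireExtension ϱ a F

/-- `φ` is a `ϱ`-KMS state at value `β`: it is a state and `φ(ab) = φ(b ϱ_{iβ}(a))` for all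
`a, b` entire for `ϱ`. -/
structure IsKMSState (ϱ : ℝ → (A ≃⋆ₐ[ℂ] A)) (β : ℝ) (φ : A →L[ℂ] ℂ) : Prop where
  isState : IsState φ
  kms : ∀ (a b : A) (F : ℂ → A), IsEntireExtension ϱ a F → IsEntireElement ϱ b →
    φ (a * b) = φ (b * F (Complex.I * β))

end KMS

/-! ### The semigroup of a rank 2 graph with a single vertex -/

namespace RankTwoGraph

variable {m n : ℕ}

/-- The commutation relations `e_i f_j = f_{j'} e_{i'}`, where `θ (i, j) = (i', j')`.  The letter
`e_i` is `Sum.inl i` and the letter `f_j` is `Sum.inr j`. -/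
inductive CommRel (θ : Equiv.Perm (Fin m × Fin n)) :
    FreeMonoid (Fin m ⊕ Fin n) → FreeMonoid (Fin m ⊕ Fin n) → Prop
  | comm (i : Fin m) (j : Fin n) :
    CommRel θ (FreeMonoid.of (Sum.inl i) * FreeMonoid.of (Sum.inr j))
      (FreeMonoid.of (Sum.inr (θ (i, j)).2) * FreeMonoid.of (Sum.inl (θ (i, j)).1))

/-- The unital semigroup generated by the `e_i` and the `f_j` subject to the commutation
relations. -/
abbrev Words (θ : Equiv.Perm (Fin m × Fin n)) : Type := PresentedMonoid (CommRel θ)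

/-- The generator `e_i`. -/
def e (θ : Equiv.Perm (Fin m × Fin n)) (i : Fin m) : Words θ :=
  PresentedMonoid.of (CommRel θ) (Sum.inl i)

/-- The generator `f_j`. -/
def f (θ : Equiv.Perm (Fin m × Fin n)) (j : Fin n) : Words θ :=
  PresentedMonoid.of (CommRel θ) (Sum.inr j)

/-- The degree map, sending `e_i` to `(1, 0)` and `f_j` to `(0, 1)`, as a homomorphism. -/
def degreeHom (θ : Equiv.Perm (Fin m × Fin n)) : Words θ →* Multiplicative (ℕ × ℕ) :=
  PresentedMonoid.lift
    (Sum.elim (fun _ => Multiplicative.ofAdd (1, 0)) (fun _ => Multiplicative.ofAdd (0, 1)))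
    (by
      rintro _ _ ⟨i, j⟩
      simp [mul_comm])

/-- The degree `d(w) = (k, l)` of a word: `k` letters `e` and `l` letters `f`. -/
def degree {θ : Equiv.Perm (Fin m × Fin n)} (w : Words θ) : ℕ × ℕ :=
  Multiplicative.toAdd (degreeHom θ w)

@[simp] lemma degree_one {θ : Equiv.Perm (Fin m × Fin n)} : degree (1 : Words θ) = 0 := by
  simp [degree]

@[simp] lemma degree_mul {θ : Equiv.Perm (Fin m × Fin n)} (u v : Words θ) :
    degree (u * v) = degree u + degree v := by
  simp [degree]

@[simp] lemma degree_e (θ : Equiv.Perm (Fin m × Fin n)) (i : Fin m) : degree (e θ i) = (1, 0) :=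
  rfl

@[simp] lemma degree_f (θ : Equiv.Perm (Fin m × Fin n)) (j : Fin n) : degree (f θ j) = (0, 1) :=
  rfl

/-- `t ^ d(w) = t₁ ^ k * t₂ ^ l` for `d(w) = (k, l)`. -/
def torusPow {θ : Equiv.Perm (Fin m × Fin n)} (t : Circle × Circle) (w : Words θ) : Circle :=
  t.1 ^ (degree w).1 * t.2 ^ (degree w).2

/-! ### The graph C*-algebra -/

/-- A family of isometries `s_u` in a unital C*-algebra, indexed by the words `u`, with
`s_∅ = 1`, `s_{uv} = s_u s_v`, and the defect free property. -/
structure DefectFreeFamily (θ : Equiv.Perm (Fin m × Fin n)) (A : Type*) [CStarAlgebra A] where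
  s : Words θ →* A
  isometry : ∀ u, star (s u) * s u = 1
  sum_e : ∑ i, s (e θ i) * star (s (e θ i)) = 1
  sum_f : ∑ j, s (f θ j) * star (s (f θ j)) = 1

lemma torusPow_smul_mul_star {A : Type*} [CStarAlgebra A] (z : Circle) (a b : A) :
    ((z : ℂ) • a) * star ((z : ℂ) • b) = a * star b := by
  have hz : (z : ℂ) * (starRingEnd ℂ) (z : ℂ) = 1 := by
    rw [Complex.mul_conj, Circle.normSq_coe, Complex.ofReal_one]
  rw [star_smul, smul_mul_smul_comm, Complex.star_def, hz, one_smul]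

lemma torusPow_star_smul_mul {A : Type*} [CStarAlgebra A] (z : Circle) (a b : A) :
    star ((z : ℂ) • a) * ((z : ℂ) • b) = star a * b := by
  have hz : (starRingEnd ℂ) (z : ℂ) * (z : ℂ) = 1 := by
    rw [mul_comm, Complex.mul_conj, Circle.normSq_coe, Complex.ofReal_one]
  rw [star_smul, smul_mul_smul_comm, Complex.star_def, hz, one_smul]

/-- The family `w ↦ t ^ d(w) s_w`. -/
def DefectFreeFamily.scale {θ : Equiv.Perm (Fin m × Fin n)} {A : Type*} [CStarAlgebra A]
    (S : DefectFreeFamily θ A) (t : Circle × Circle) : DefectFreeFamily θ A where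
  s :=
    { toFun := fun w => (torusPow t w : ℂ) • S.s w
      map_one' := by simp [torusPow]
      map_mul' := fun u v => by
        rw [smul_mul_smul_comm, ← map_mul, ← Circle.coe_mul]
        congr 2
        simp only [torusPow, degree_mul, Prod.fst_add, Prod.snd_add, pow_add]
        ac_rfl }
  isometry u := by
    change star ((torusPow t u : ℂ) • S.s u) * ((torusPow t u : ℂ) • S.s u) = 1
    rw [torusPow_star_smul_mul, S.isometry u]
  sum_e := by
    exact (Finset.sum_congr rfl fun i _ => torusPow_smul_mul_star _ _ _).trans S.sum_e
  sum_f := by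
    exact (Finset.sum_congr rfl fun i _ => torusPow_smul_mul_star _ _ _).trans S.sum_f

/-- A representation of the defining relations in a (nonzero) unital C*-algebra. -/
structure Rep (θ : Equiv.Perm (Fin m × Fin n)) : Type 1 where
  carrier : Type
  [cstar : CStarAlgebra carrier]
  [nontrivial : Nontrivial carrier]
  family : DefectFreeFamily θ carrier

attribute [instance] Rep.cstar Rep.nontrivial

/-- The bounded sections of the product of all representations. -/
abbrev RepProduct (θ : Equiv.Perm (Fin m × Fin n)) : Type 1 :=
  lp (fun π : Rep θ => π.carrier) ∞

instance (θ : Equiv.Perm (Fin m × Fin n)) : CStarAlgebra (RepProduct θ) where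

/-- The universal family in the product of all representations. -/
def prodFamily (θ : Equiv.Perm (Fin m × Fin n)) : DefectFreeFamily θ (RepProduct θ) where
  s :=
    { toFun := fun w => ⟨fun π => π.family.s w, memℓp_infty ⟨1, by
        rintro _ ⟨π, rfl⟩
        have h : ‖π.family.s w‖ * ‖π.family.s w‖ = 1 := by
          rw [← CStarRing.norm_star_mul_self, π.family.isometry, norm_one]
        nlinarith [norm_nonneg (π.family.s w)]⟩⟩
      map_one' := by ext π; simp
      map_mul' := fun u v => by ext π; simp }
  isometry u := by
    ext π
    exact π.family.isometry u
  sum_e := by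
    ext π
    rw [lp.coeFn_sum, Finset.sum_apply]
    exact π.family.sum_e
  sum_f := by
    ext π
    rw [lp.coeFn_sum, Finset.sum_apply]
    exact π.family.sum_f

/-- The closed *-subalgebra generated by the universal family. -/
def graphSubalgebra (θ : Equiv.Perm (Fin m × Fin n)) : StarSubalgebra ℂ (RepProduct θ) :=
  (StarAlgebra.adjoin ℂ (Set.range (prodFamily θ).s)).topologicalClosure

/-- The graph C*-algebra `O_θ`: the universal C*-algebra generated by a family of isometries
`s_u` satisfying the relations of `DefectFreeFamily`.  It is realised inside the product of all
representations of the relations on C*-algebras `A : Type`; this loses no representation up to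
isomorphism, as the C*-algebra generated by a countable family has at most the cardinality of the
continuum.  The universal property is `existsUnique_lift`. -/
def GraphAlgebra (θ : Equiv.Perm (Fin m × Fin n)) : Type 1 := graphSubalgebra θ

/-- The C*-algebra structure inherited from the product. -/
def graphCStarAlgebra (θ : Equiv.Perm (Fin m × Fin n)) : CStarAlgebra (GraphAlgebra θ) :=
  StarSubalgebra.cstarAlgebra (graphSubalgebra θ)
    (h_closed := StarSubalgebra.isClosed_topologicalClosure _)

instance (θ : Equiv.Perm (Fin m × Fin n)) : CStarAlgebra (GraphAlgebra θ) :=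
  graphCStarAlgebra θ

/-- The inclusion of `O_θ` into the product of all representations. -/
def incl (θ : Equiv.Perm (Fin m × Fin n)) : GraphAlgebra θ →⋆ₐ[ℂ] RepProduct θ :=
  { toFun := Subtype.val, map_one' := rfl, map_mul' := fun _ _ => rfl, map_zero' := rfl,
    map_add' := fun _ _ => rfl, commutes' := fun _ => rfl, map_star' := fun _ => rfl }

lemma incl_injective (θ : Equiv.Perm (Fin m × Fin n)) : Function.Injective (incl θ) :=
  Subtype.val_injective

/-- The generating family `s_u` of `O_θ`. -/
def family (θ : Equiv.Perm (Fin m × Fin n)) : DefectFreeFamily θ (GraphAlgebra θ) where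
  s :=
    { toFun := fun w => ⟨(prodFamily θ).s w, StarSubalgebra.le_topologicalClosure _
        (StarAlgebra.subset_adjoin ℂ _ ⟨w, rfl⟩)⟩
      map_one' := incl_injective θ (map_one (prodFamily θ).s)
      map_mul' := fun u v => incl_injective θ (map_mul (prodFamily θ).s u v) }
  isometry u := incl_injective θ ((prodFamily θ).isometry u)
  sum_e := incl_injective θ 
    ((map_sum (incl θ) _ _).trans (prodFamily θ).sum_e)
  sum_f := incl_injective θ 
    ((map_sum (incl θ) _ _).trans (prodFamily θ).sum_f)

/-- The generator `s_w` of `O_θ`. -/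
def s {θ : Equiv.Perm (Fin m × Fin n)} (w : Words θ) : GraphAlgebra θ := (family θ).s w

/-- Induction principle: a closed property that holds on the generators and is stable under the
algebraic operations holds on `O_θ`. -/
lemma induction_on {θ : Equiv.Perm (Fin m × Fin n)} (S : StarSubalgebra ℂ (GraphAlgebra θ))
    (hS : IsClosed (S : Set (GraphAlgebra θ))) (hs : ∀ w, s w ∈ S) (a : GraphAlgebra θ) :
    a ∈ S := by
  have hadj : ∀ x (hx : x ∈ StarAlgebra.adjoin ℂ (Set.range (prodFamily θ).s)),
      (⟨x, StarSubalgebra.le_topologicalClosure _ hx⟩ : GraphAlgebra θ) ∈ S := by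
    intro x hx
    induction hx using StarAlgebra.adjoin_induction with
    | mem x hx =>
      obtain ⟨w, rfl⟩ := hx
      exact hs w
    | algebraMap r => exact S.algebraMap_mem r
    | add x y hx hy h1 h2 => exact S.add_mem h1 h2
    | mul x y hx hy h1 h2 => exact S.mul_mem h1 h2
    | star x hx h1 =>
      exact S.star_mem' h1
  have hd : closure {b : GraphAlgebra θ |
      incl θ b ∈ StarAlgebra.adjoin ℂ (Set.range (prodFamily θ).s)} = Set.univ := by
    rw [Set.eq_univ_iff_forall]
    intro b
    have hemb : Topology.IsInducing (incl θ) := Topology.IsInducing.subtypeVal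
    rw [hemb.closure_eq_preimage_closure_image]
    have hb : incl θ b ∈ closure
        (StarAlgebra.adjoin ℂ (Set.range (prodFamily θ).s) : Set (RepProduct θ)) := b.2
    refine closure_mono ?_ hb
    intro x hx
    exact ⟨⟨x, StarSubalgebra.le_topologicalClosure _ hx⟩, hx, rfl⟩
  have : closure {b : GraphAlgebra θ |
      incl θ b ∈ StarAlgebra.adjoin ℂ (Set.range (prodFamily θ).s)} ⊆ S :=
    closure_minimal (fun b hb => hadj b.1 hb) hS
  exact this (hd ▸ Set.mem_univ a)

/-- *-homomorphisms on `O_θ` are determined by their values on the generators. -/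
lemma hom_ext {θ : Equiv.Perm (Fin m × Fin n)} {B : Type*} [CStarAlgebra B]
    {φ ψ : GraphAlgebra θ →⋆ₐ[ℂ] B} (h : ∀ w, φ (s w) = ψ (s w)) : φ = ψ := by
  ext a
  refine induction_on (StarAlgHom.equalizer φ ψ) ?_ h a
  exact isClosed_eq (map_continuous φ) (map_continuous ψ)

/-- The universal property of `O_θ`. -/
theorem existsUnique_lift {θ : Equiv.Perm (Fin m × Fin n)} {B : Type} [CStarAlgebra B]
    (S : DefectFreeFamily θ B) : ∃! φ : GraphAlgebra θ →⋆ₐ[ℂ] B, ∀ w, φ (s w) = S.s w := by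
  refine existsUnique_of_exists_of_unique ?_ fun φ ψ hφ hψ =>
    hom_ext fun w => (hφ w).trans (hψ w).symm
  cases subsingleton_or_nontrivial B with
  | inl h =>
    exact ⟨{ toFun := fun _ => 0, map_one' := Subsingleton.elim _ _,
             map_mul' := fun _ _ => Subsingleton.elim _ _, map_zero' := rfl,
             map_add' := fun _ _ => Subsingleton.elim _ _,
             commutes' := fun _ => Subsingleton.elim _ _,
             map_star' := fun _ => Subsingleton.elim _ _ }, fun _ => Subsingleton.elim _ _⟩
  | inr h =>
    let π : Rep θ := ⟨B, S⟩
    exact ⟨{ toFun := fun a => incl θ a π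
             map_one' := by simp
             map_mul' := fun a b => by simp
             map_zero' := by simp
             map_add' := fun a b => by simp
             commutes' := fun r => by
              rw [AlgHomClass.commutes]
              rfl
             map_star' := fun a => by simp [map_star] }, fun w => rfl⟩

/-! ### The gauge action -/

/-- Composing all representations with the rescaling of the generators by `t`. -/
def reindex (θ : Equiv.Perm (Fin m × Fin n)) (t : Circle × Circle) :
    RepProduct θ →⋆ₐ[ℂ] RepProduct θ where
  toFun x := ⟨fun π => x (⟨π.carrier, π.family.scale t⟩ : Rep θ), memℓp_infty ⟨‖x‖, by
    rintro _ ⟨π, rfl⟩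
    exact lp.norm_apply_le_norm ENNReal.top_ne_zero x _⟩⟩
  map_one' := rfl
  map_mul' _ _ := rfl
  map_zero' := rfl
  map_add' _ _ := rfl
  commutes' _ := rfl
  map_star' _ := rfl

lemma reindex_mem (θ : Equiv.Perm (Fin m × Fin n)) (t : Circle × Circle) (a : GraphAlgebra θ) :
    reindex θ t (incl θ a) ∈ graphSubalgebra θ := by
  refine induction_on ((graphSubalgebra θ).comap ((reindex θ t).comp (incl θ))) ?_ ?_ a
  · exact (StarSubalgebra.isClosed_topologicalClosure _).preimage
      (map_continuous ((reindex θ t).comp (incl θ)))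
  · intro w
    have h : reindex θ t (incl θ (s w)) = (torusPow t w : ℂ) • incl θ (s w) := rfl
    change reindex θ t (incl θ (s w)) ∈ graphSubalgebra θ
    rw [h]
    exact (graphSubalgebra θ).smul_mem (s w).2 _

/-- The gauge endomorphism determined by `t ∈ 𝕋²`. -/
def gaugeHom (θ : Equiv.Perm (Fin m × Fin n)) (t : Circle × Circle) :
    GraphAlgebra θ →⋆ₐ[ℂ] GraphAlgebra θ :=
  { toFun := fun a => ⟨reindex θ t (incl θ a), reindex_mem θ t a⟩
    map_one' := rfl
    map_mul' := fun _ _ => rfl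
    map_zero' := rfl
    map_add' := fun _ _ => rfl
    commutes' := fun _ => rfl
    map_star' := fun _ => rfl }

lemma gaugeHom_s {θ : Equiv.Perm (Fin m × Fin n)} (t : Circle × Circle) (w : Words θ) :
    gaugeHom θ t (s w) = (torusPow t w : ℂ) • s w := rfl

lemma gaugeHom_comp (θ : Equiv.Perm (Fin m × Fin n)) (t u : Circle × Circle) :
    (gaugeHom θ t).comp (gaugeHom θ u) = gaugeHom θ (t * u) := by
  refine hom_ext fun w => ?_
  rw [StarAlgHom.comp_apply, gaugeHom_s, map_smul, gaugeHom_s, gaugeHom_s, smul_smul,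
    ← Circle.coe_mul]
  congr 2
  simp only [torusPow, Prod.fst_mul, Prod.snd_mul, mul_pow]
  ac_rfl

lemma gaugeHom_one (θ : Equiv.Perm (Fin m × Fin n)) :
    gaugeHom θ 1 = StarAlgHom.id ℂ (GraphAlgebra θ) := by
  refine hom_ext fun w => ?_
  rw [gaugeHom_s]
  simp [torusPow]

/-- The gauge automorphism `γ_t`, `t ∈ 𝕋²`, given by `γ_t(s_w) = t ^ d(w) s_w`. -/
def gauge (θ : Equiv.Perm (Fin m × Fin n)) (t : Circle × Circle) :
    GraphAlgebra θ ≃⋆ₐ[ℂ] GraphAlgebra θ :=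
  StarAlgEquiv.ofStarAlgHom (gaugeHom θ t) (gaugeHom θ t⁻¹)
    (by rw [gaugeHom_comp, inv_mul_cancel, gaugeHom_one])
    (by rw [gaugeHom_comp, mul_inv_cancel, gaugeHom_one])

lemma gauge_s {θ : Equiv.Perm (Fin m × Fin n)} (t : Circle × Circle) (w : Words θ) :
    gauge θ t (s w) = (torusPow t w : ℂ) • s w := rfl

lemma gauge_mul (θ : Equiv.Perm (Fin m × Fin n)) (t u : Circle × Circle) (a : GraphAlgebra θ) :
    gauge θ (t * u) a = gauge θ t (gauge θ u a) :=
  (DFunLike.congr_fun (gaugeHom_comp θ t u) a).symm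

/-- The gauge action is strongly continuous. -/
lemma continuous_gauge (θ : Equiv.Perm (Fin m × Fin n)) (a : GraphAlgebra θ) :
    Continuous fun t => gauge θ t a := by
  let S : StarSubalgebra ℂ (GraphAlgebra θ) :=
    { carrier := {a | Continuous fun t => gauge θ t a}
      mul_mem' := fun ha hb => by
        simp only [Set.mem_ofPred_eq, map_mul] at *
        exact ha.mul hb
      add_mem' := fun ha hb => by
        simp only [Set.mem_ofPred_eq, map_add] at *
        exact ha.add hb
      algebraMap_mem' := fun r => by
        have : ∀ t, gauge θ t (algebraMap ℂ (GraphAlgebra θ) r) = algebraMap ℂ _ r := fun t => by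
          rw [Algebra.algebraMap_eq_smul_one, map_smul, map_one]
        simp only [Set.mem_ofPred_eq, this]
        exact continuous_const
      star_mem' := fun ha => by
        simp only [Set.mem_ofPred_eq, map_star] at *
        exact ha.star }
  refine induction_on S ?_ ?_ a
  · refine isClosed_of_closure_subset fun b hb => ?_
    refine continuous_of_uniform_approx_of_continuous fun u hu => ?_
    obtain ⟨ε, hε, hεu⟩ := Metric.mem_uniformity_dist.1 hu
    obtain ⟨c, hc, hbc⟩ := Metric.mem_closure_iff.1 hb ε hε
    refine ⟨fun t => gauge θ t c, hc, fun t => hεu ?_⟩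
    rwa [(StarAlgEquiv.isometry (gauge θ t)).dist_eq]
  · intro w
    change Continuous fun t : Circle × Circle => (torusPow t w : ℂ) • (s w : GraphAlgebra θ)
    unfold torusPow
    fun_prop

/-- The fixed point algebra `𝔉` of the gauge action. -/
abbrev gaugeFixed (θ : Equiv.Perm (Fin m × Fin n)) : StarSubalgebra ℂ (GraphAlgebra θ) :=
  fixedAlgebra (gauge θ)

/-- The point of `𝕋²` with the given coordinates in `(ℝ/ℤ)²`; under this identification the
normalised Haar measure of `𝕋²` is the product measure `volume` on `(ℝ/ℤ)²`. -/
def torusPoint (x : UnitAddCircle × UnitAddCircle) : Circle × Circle :=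
  (AddCircle.toCircle x.1, AddCircle.toCircle x.2)

lemma continuous_torusPoint : Continuous torusPoint :=
  (AddCircle.continuous_toCircle.comp continuous_fst).prodMk
    (AddCircle.continuous_toCircle.comp continuous_snd)

lemma exists_torusPoint (t : Circle × Circle) : ∃ x, torusPoint x = t := by
  obtain ⟨x, hx⟩ := (AddCircle.homeomorphCircle (one_ne_zero (α := ℝ))).surjective t.1
  obtain ⟨y, hy⟩ := (AddCircle.homeomorphCircle (one_ne_zero (α := ℝ))).surjective t.2
  exact ⟨(x, y), Prod.ext ((AddCircle.homeomorphCircle_apply _ x).symm.trans hx)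
    ((AddCircle.homeomorphCircle_apply _ y).symm.trans hy)⟩

lemma torusPoint_add (x y : UnitAddCircle × UnitAddCircle) :
    torusPoint (x + y) = torusPoint x * torusPoint y := by
  simp [torusPoint, AddCircle.toCircle_add]

lemma integrable_gauge (θ : Equiv.Perm (Fin m × Fin n)) (a : GraphAlgebra θ) :
    MeasureTheory.Integrable (fun x : UnitAddCircle × UnitAddCircle =>
      gauge θ (torusPoint x) a) :=
  ((continuous_gauge θ a).comp continuous_torusPoint).integrable_of_hasCompactSupport
    (HasCompactSupport.of_compactSpace _)

lemma gauge_integral (θ : Equiv.Perm (Fin m × Fin n)) (t : Circle × Circle)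
    (a : GraphAlgebra θ) :
    gauge θ t (∫ x : UnitAddCircle × UnitAddCircle, gauge θ (torusPoint x) a) =
      ∫ x : UnitAddCircle × UnitAddCircle, gauge θ (torusPoint x) a := by
  obtain ⟨y, rfl⟩ := exists_torusPoint t
  let L : GraphAlgebra θ →L[ℂ] GraphAlgebra θ :=
    { toFun := gauge θ (torusPoint y), map_add' := map_add _, map_smul' := map_smul _,
      cont := (StarAlgEquiv.isometry _).continuous }
  have h := L.integral_comp_comm (integrable_gauge θ a)
  refine h.symm.trans ?_
  have h2 : ∀ x, L (gauge θ (torusPoint x) a) = gauge θ (torusPoint (y + x)) a := fun x => by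
    rw [torusPoint_add, gauge_mul]
    rfl
  simp_rw [h2]
  have : (MeasureTheory.volume : MeasureTheory.Measure
      (UnitAddCircle × UnitAddCircle)).IsAddLeftInvariant :=
    MeasureTheory.Measure.prod.instIsAddLeftInvariant
  exact MeasureTheory.integral_add_left_eq_self (fun x => gauge θ (torusPoint x) a) y

lemma torus_isProbabilityMeasure : MeasureTheory.IsProbabilityMeasure
    (MeasureTheory.volume : MeasureTheory.Measure (UnitAddCircle × UnitAddCircle)) :=
  ⟨by rw [MeasureTheory.Measure.volume_eq_prod, ← Set.univ_prod_univ,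
    MeasureTheory.Measure.prod_prod, UnitAddCircle.measure_univ, mul_one]⟩

/-- The expectation `Φ(X) = ∫_{𝕋²} γ_t(X) dt` of `O_θ` onto `𝔉`. -/
def expectation (θ : Equiv.Perm (Fin m × Fin n)) : GraphAlgebra θ →L[ℂ] gaugeFixed θ :=
  LinearMap.mkContinuous
    { toFun := fun a => ⟨∫ x : UnitAddCircle × UnitAddCircle, gauge θ (torusPoint x) a,
        fun t => gauge_integral θ t a⟩
      map_add' := fun a b => Subtype.ext <| by
        simp only [map_add]
        exact MeasureTheory.integral_add (integrable_gauge θ a) (integrable_gauge θ b)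
      map_smul' := fun r a => Subtype.ext <| by
        simp only [map_smul]
        exact MeasureTheory.integral_smul r _ }
    1 fun a => by
      have h := MeasureTheory.norm_integral_le_of_norm_le_const (C := ‖a‖)
        (μ := (MeasureTheory.volume : MeasureTheory.Measure (UnitAddCircle × UnitAddCircle)))
        (f := fun x => gauge θ (torusPoint x) a)
        (Filter.Eventually.of_forall fun x =>
          (StarAlgEquiv.norm_map (gauge θ (torusPoint x)) a).le)
      have := torus_isProbabilityMeasure
      rw [one_mul]
      refine h.trans (le_of_eq ?_)
      rw [MeasureTheory.probReal_univ, mul_one]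

/-- The functional `τ ∘ Φ` on `O_θ` induced by a functional `τ` on `𝔉`. -/
def inducedFunctional {θ : Equiv.Perm (Fin m × Fin n)} (τ : gaugeFixed θ →L[ℂ] ℂ) :
    GraphAlgebra θ →L[ℂ] ℂ :=
  τ.comp (expectation θ)

/-! ### The modular action -/

/-- The action `σ` of `ℝ` on `O_θ`: `σ_t = γ_{(m^{-it}, n^{-it})}`, that is,
`σ_t(s_u s_v^*) = m^{it(k'-k)} n^{it(l'-l)} s_u s_v^*` for `d(u) = (k, l)`, `d(v) = (k', l')`. -/
def modular (θ : Equiv.Perm (Fin m × Fin n)) (t : ℝ) : GraphAlgebra θ ≃⋆ₐ[ℂ] GraphAlgebra θ :=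
  gauge θ (Circle.exp (-(t * Real.log m)), Circle.exp (-(t * Real.log n)))

lemma modular_apply {θ : Equiv.Perm (Fin m × Fin n)} (t : ℝ) (u v : Words θ) :
    modular θ t (s u * star (s v)) =
      Complex.exp (Complex.I * t *
        ((((degree v).1 : ℂ) - (degree u).1) * Real.log m +
          (((degree v).2 : ℂ) - (degree u).2) * Real.log n)) • (s u * star (s v)) := by
  rw [modular, map_mul, map_star, gauge_s, gauge_s, star_smul, smul_mul_smul_comm]
  congr 1
  simp only [torusPow, Circle.coe_mul, Circle.coe_pow, Circle.coe_exp,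
    Complex.star_def, ← Complex.exp_conj, ← Complex.exp_nat_mul, ← Complex.exp_add]
  congr 1
  simp only [map_add, map_mul, map_natCast, Complex.conj_I, Complex.conj_ofReal]
  push_cast
  ring

/-- The fixed point algebra `O_θ^σ` of `σ`. -/
abbrev modularFixed (θ : Equiv.Perm (Fin m × Fin n)) : StarSubalgebra ℂ (GraphAlgebra θ) :=
  fixedAlgebra (modular θ)

end RankTwoGraph

end

noncomputable section

/-! ### Isometries whose range projections sum to one -/

/-! Two facts hold for every tracial state `τ` on `𝔉`. It is the only one (`IsTracialState.eq`):
`τ(s_u s_v^*)` with `d(u) = d(v)` is found by removing one letter at a time. Different first letters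
of the same kind give zero; equal ones give `1/m` or `1/n` times the value of another trace, `τ`
composed with `x ↦ ∑ s_{g_i} x s_{g_i}^*`. And `ω = τ ∘ Φ` is KMS: that shifted trace must be `τ`
itself, so `m ω(s_{e_i} b) = ω(b s_{e_i})`, likewise for `f_j`, and words scale by `m^k n^l`, which
is what `σ_{-i}` prescribes (`IsTracialState.isKMSState_inducedFunctional`).

The hypothesis on `O_θ^σ` enters twice. Since `𝔉 ⊆ O_θ^σ`, its trace restricts to a trace on `𝔉`.
Conversely a KMS state is a trace on `O_θ^σ`, hence agrees there with `ω`, and it vanishes on every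
`s_u s_v^*` that `σ` moves (`IsKMSState.apply_eq_zero`). As the `s_u s_v^*` span a dense subspace
(`closedSpan_eq_top`), it equals `ω`. -/

/-- Isometries whose range projections sum to one have pairwise orthogonal ranges. -/
lemma star_mul_eq_zero_of_sum_mul_star_eq_one {A : Type*} [CStarAlgebra A] {ι : Type*} [Fintype ι]
    {v : ι → A} (hv : ∀ i, star (v i) * v i = 1) (hsum : ∑ i, v i * star (v i) = 1)
    {i j : ι} (hij : i ≠ j) : star (v i) * v j = 0 := by
  classical
  let _ := CStarAlgebra.spectralOrder A
  let _ := CStarAlgebra.spectralOrderedRing A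
  have h1 : ∑ k, star (star (v k) * v j) * (star (v k) * v j) = 1 := by
    calc ∑ k, star (star (v k) * v j) * (star (v k) * v j)
        = star (v j) * (∑ k, v k * star (v k)) * v j := by
          rw [Finset.mul_sum, Finset.sum_mul]
          exact Finset.sum_congr rfl fun k _ => by rw [star_mul, star_star]; noncomm_ring
      _ = 1 := by rw [hsum, mul_one, hv]
  rw [← Finset.add_sum_erase _ _ (Finset.mem_univ j), hv, star_one, one_mul, add_eq_left,
    Finset.sum_eq_zero_iff_of_nonneg fun k _ => star_mul_self_nonneg _] at h1
  exact (CStarRing.star_mul_self_eq_zero_iff _).1 (h1 i (by simp [hij]))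

namespace RankTwoGraph

variable {m n : ℕ} {θ : Equiv.Perm (Fin m × Fin n)}

/-! ### Words -/

lemma e_mul_f (i : Fin m) (j : Fin n) :
    e θ i * f θ j = f θ (θ (i, j)).2 * e θ (θ (i, j)).1 :=
  PresentedMonoid.mk_eq_mk_of_rel (CommRel.comm i j)

lemma f_mul_e (j : Fin n) (i : Fin m) :
    f θ j * e θ i = e θ (θ.symm (i, j)).1 * f θ (θ.symm (i, j)).2 := by
  simp [e_mul_f]

/-- Induction on words by multiplication with a generator from the left. -/
lemma word_induction {P : Words θ → Prop} (one : P 1) (he : ∀ i w, P w → P (e θ i * w))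
    (hf : ∀ j w, P w → P (f θ j * w)) (w : Words θ) : P w := by
  obtain ⟨x, rfl⟩ := PresentedMonoid.surjective_mk w
  induction x using FreeMonoid.inductionOn' with
  | one => exact one
  | of_mul x xs ih =>
    rw [map_mul]
    cases x with
    | inl i => exact he i _ ih
    | inr j => exact hf j _ ih

/-- Since `θ` is invertible, letters of different kinds pass each other in both directions, so any
`e` can be brought to the front. -/
lemma exists_eq_e_mul (w : Words θ) (hw : (degree w).1 ≠ 0) : ∃ i w', w = e θ i * w' := by
  induction w using word_induction with
  | one => simp at hw
  | he i w _ => exact ⟨i, w, rfl⟩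
  | hf j w ih =>
    obtain ⟨i, w', rfl⟩ := ih (by simpa using hw)
    exact ⟨_, _, by rw [← mul_assoc, f_mul_e, mul_assoc]⟩

lemma exists_eq_f_mul (w : Words θ) (hw : (degree w).2 ≠ 0) : ∃ j w', w = f θ j * w' := by
  induction w using word_induction with
  | one => simp at hw
  | hf j w _ => exact ⟨j, w, rfl⟩
  | he i w ih =>
    obtain ⟨j, w', rfl⟩ := ih (by simpa using hw)
    exact ⟨_, _, by rw [← mul_assoc, e_mul_f, mul_assoc]⟩

/-! ### Generators -/

lemma s_one : s (1 : Words θ) = 1 := map_one (family θ).s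

lemma s_mul (u v : Words θ) : s (u * v) = s u * s v := map_mul (family θ).s u v

lemma star_s_mul_s (u : Words θ) : star (s u) * s u = 1 := (family θ).isometry u

lemma sum_s_e : ∑ i, s (e θ i) * star (s (e θ i)) = 1 := (family θ).sum_e

lemma sum_s_f : ∑ j, s (f θ j) * star (s (f θ j)) = 1 := (family θ).sum_f

/-! ### Density of the span of the elements `s_u s_v^*` -/

variable (θ) in
/-- The closed linear span of the elements `s_u s_v^*`. -/
def closedSpan : Submodule ℂ (GraphAlgebra θ) :=
  (Submodule.span ℂ
    (Set.range fun p : Words θ × Words θ => s p.1 * star (s p.2))).topologicalClosure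

lemma mem_closedSpan (u v : Words θ) : s u * star (s v) ∈ closedSpan θ :=
  Submodule.le_topologicalClosure _ (Submodule.subset_span ⟨(u, v), rfl⟩)

/-- A closed submodule containing all `s_u s_v^*` contains `closedSpan`. -/
lemma closedSpan_le {K : Submodule ℂ (GraphAlgebra θ)} (hK : IsClosed (K : Set (GraphAlgebra θ)))
    (h : ∀ u v : Words θ, s u * star (s v) ∈ K) : closedSpan θ ≤ K :=
  Submodule.topologicalClosure_minimal _
    (Submodule.span_le.2 (by rintro _ ⟨p, rfl⟩; exact h p.1 p.2)) hK

lemma mul_mem_closedSpan {a : GraphAlgebra θ}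
    (h : ∀ u v : Words θ, a * (s u * star (s v)) ∈ closedSpan θ) {b : GraphAlgebra θ}
    (hb : b ∈ closedSpan θ) : a * b ∈ closedSpan θ :=
  closedSpan_le (K := (closedSpan θ).comap (LinearMap.mulLeft ℂ a))
    ((Submodule.isClosed_topologicalClosure _).preimage (continuous_const_mul a)) h hb

/-- Compressing by a generator of a family whose range projections sum to one. -/
lemma star_s_mul_mem_closedSpan {k : ℕ} {g : Fin k → Words θ}
    (hsum : ∑ i, s (g i) * star (s (g i)) = 1)
    (hg : ∀ u i, ∃ j u', u * g i = g j * u') (i : Fin k) (u v : Words θ) :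
    star (s (g i)) * (s u * star (s v)) ∈ closedSpan θ := by
  -- Inserting the sum of range projections in the middle lengthens `u` by a letter of the right
  -- kind, which can then be moved to the front to meet `star (s (g i))`.
  have h1 : s u * star (s v) = ∑ l, s (u * g l) * star (s (v * g l)) := by
    calc s u * star (s v) = s u * (∑ l, s (g l) * star (s (g l))) * star (s v) := by
          rw [hsum, mul_one]
      _ = _ := by
          rw [Finset.mul_sum, Finset.sum_mul]
          exact Finset.sum_congr rfl fun l _ => by rw [s_mul, s_mul, star_mul]; noncomm_ring
  rw [h1, Finset.mul_sum]
  refine Submodule.sum_mem _ fun l _ => ?_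
  obtain ⟨j, u', hu⟩ := hg u l
  rw [hu, s_mul, mul_assoc, ← mul_assoc (star (s (g i)))]
  by_cases hij : i = j
  · rw [hij, star_s_mul_s, one_mul]
    exact mem_closedSpan _ _
  · rw [star_mul_eq_zero_of_sum_mul_star_eq_one (fun i => star_s_mul_s (g i)) hsum hij, zero_mul]
    exact zero_mem _

/-- The elements `s_u s_v^*` have dense linear span. -/
lemma closedSpan_eq_top : closedSpan θ = ⊤ := by
  -- `S` consists of the `a` for which `a` and `star a` both multiply the closed span into itself.
  -- It contains the generators, hence everything; applying it to `1` finishes.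
  let S : StarSubalgebra ℂ (GraphAlgebra θ) :=
    { carrier := {a | (∀ b ∈ closedSpan θ, a * b ∈ closedSpan θ) ∧
        ∀ b ∈ closedSpan θ, star a * b ∈ closedSpan θ}
      mul_mem' := fun {a a'} ha ha' => ⟨fun b hb => by
          rw [mul_assoc]; exact ha.1 _ (ha'.1 _ hb), fun b hb => by
          rw [star_mul, mul_assoc]; exact ha'.2 _ (ha.2 _ hb)⟩
      add_mem' := fun {a a'} ha ha' => ⟨fun b hb => by
          rw [add_mul]; exact add_mem (ha.1 _ hb) (ha'.1 _ hb), fun b hb => by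
          rw [star_add, add_mul]; exact add_mem (ha.2 _ hb) (ha'.2 _ hb)⟩
      algebraMap_mem' := fun r => ⟨fun b hb => by
          rw [← Algebra.smul_def]; exact Submodule.smul_mem _ _ hb, fun b hb => by
          rw [← algebraMap_star_comm, ← Algebra.smul_def]; exact Submodule.smul_mem _ _ hb⟩
      star_mem' := fun {a} ha => ⟨ha.2, by simpa using ha.1⟩ }
  have hcl : IsClosed (closedSpan θ : Set (GraphAlgebra θ)) :=
    Submodule.isClosed_topologicalClosure _
  have hS : IsClosed (S : Set (GraphAlgebra θ)) := by
    have : (S : Set (GraphAlgebra θ)) = (⋂ b ∈ closedSpan θ, {a | a * b ∈ closedSpan θ}) ∩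
        ⋂ b ∈ closedSpan θ, {a | star a * b ∈ closedSpan θ} := by
      ext a
      simp [S]
    rw [this]
    exact (isClosed_biInter fun b _ => hcl.preimage (by fun_prop)).inter
      (isClosed_biInter fun b _ => hcl.preimage (by fun_prop))
  have hmul : ∀ w u v : Words θ, s w * (s u * star (s v)) ∈ closedSpan θ := fun w u v => by
    rw [← mul_assoc, ← s_mul]
    exact mem_closedSpan _ _
  have hs : ∀ w : Words θ, s w ∈ S := fun w => by
    induction w using word_induction with
    | one => rw [s_one]; exact one_mem S
    | he i w ih =>
      rw [s_mul]
      refine mul_mem ⟨fun b => mul_mem_closedSpan (hmul _), fun b => mul_mem_closedSpan ?_⟩ ih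
      exact star_s_mul_mem_closedSpan sum_s_e (fun u i => exists_eq_e_mul _ (by simp)) i
    | hf j w ih =>
      rw [s_mul]
      refine mul_mem ⟨fun b => mul_mem_closedSpan (hmul _), fun b => mul_mem_closedSpan ?_⟩ ih
      exact star_s_mul_mem_closedSpan sum_s_f (fun u i => exists_eq_f_mul _ (by simp)) j
  rw [Submodule.eq_top_iff']
  intro a
  have h1 : (1 : GraphAlgebra θ) ∈ closedSpan θ := by
    simpa [s_one] using mem_closedSpan (1 : Words θ) 1
  simpa using (induction_on S hS hs a).1 1 h1

/-- Continuous linear maps on `O_θ` are determined by their values on the elements `s_u s_v^*`. -/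
lemma clm_ext {E : Type*} [NormedAddCommGroup E] [NormedSpace ℂ E] {φ ψ : GraphAlgebra θ →L[ℂ] E}
    (h : ∀ u v : Words θ, φ (s u * star (s v)) = ψ (s u * star (s v))) : φ = ψ := by
  ext a
  have : a ∈ closedSpan θ := closedSpan_eq_top ▸ Submodule.mem_top
  exact closedSpan_le (K := LinearMap.eqLocus φ.toLinearMap ψ.toLinearMap)
    (isClosed_eq φ.continuous ψ.continuous) h this

/-! ### The expectation -/

lemma torusPow_eq {u v : Words θ} (h : degree u = degree v) (t : Circle × Circle) :
    torusPow t u = torusPow t v := by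
  simp [torusPow, h]

/-- Irrationality of `π`: the point `exp(i)` of the circle is not a root of unity, so it alone
separates exponents. -/
lemma circle_exp_one_pow_injective : Function.Injective fun k : ℕ => Circle.exp 1 ^ k := by
  intro k l h
  have h' : Circle.exp (k : ℝ) = Circle.exp (l : ℝ) := by
    have hp : ∀ k : ℕ, Circle.exp (k : ℝ) = Circle.exp 1 ^ k := fun k => by
      ext
      simp [← Complex.exp_nat_mul]
    rw [hp, hp]
    exact h
  obtain ⟨z, hz⟩ := Circle.exp_eq_exp.1 h'
  by_contra hkl
  have hz0 : (z : ℝ) ≠ 0 := by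
    rintro h0
    rw [h0, zero_mul, add_zero] at hz
    exact hkl (by exact_mod_cast hz)
  refine irrational_pi ⟨((k : ℚ) - l) / (z * 2), ?_⟩
  push_cast
  rw [div_eq_iff (by simpa using hz0)]
  linarith

/-- The degree is determined by the characters `t ↦ t ^ d(w)`. -/
lemma exists_torusPow_ne {u v : Words θ} (h : degree u ≠ degree v) :
    ∃ t, torusPow t u ≠ torusPow t v := by
  by_contra! hc
  refine h (Prod.ext ?_ ?_)
  · exact circle_exp_one_pow_injective (by simpa [torusPow] using hc (Circle.exp 1, 1))
  · exact circle_exp_one_pow_injective (by simpa [torusPow] using hc (1, Circle.exp 1))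

lemma coe_expectation (a : GraphAlgebra θ) : (expectation θ a : GraphAlgebra θ) =
    ∫ x : UnitAddCircle × UnitAddCircle, gauge θ (torusPoint x) a := rfl

lemma expectation_coe (x : gaugeFixed θ) : expectation θ (x : GraphAlgebra θ) = x := by
  have := torus_isProbabilityMeasure
  refine Subtype.ext ?_
  rw [coe_expectation]
  simp [x.2 _]

/-- The expectation vanishes on the spectral subspaces of nontrivial characters. -/
lemma expectation_eq_zero {a : GraphAlgebra θ} {u v : Words θ} (huv : degree u ≠ degree v)
    (h : ∀ t, gauge θ t a = ((torusPow t u : ℂ) * star (torusPow t v : ℂ)) • a) :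
    expectation θ a = 0 := by
  refine Subtype.ext ?_
  obtain ⟨t, ht⟩ := exists_torusPow_ne huv
  -- The integrand is a scalar function times `a`, so the expectation is a multiple of `a`: it
  -- transforms by the nontrivial character, yet it is gauge invariant.
  obtain ⟨z, hz⟩ : ∃ z : ℂ, (expectation θ a : GraphAlgebra θ) = z • a := by
    rw [coe_expectation]
    simp_rw [h]
    exact ⟨_, integral_smul_const _ _⟩
  have h1 := (expectation θ a).2 t
  rw [hz, map_smul, h, smul_comm, ← hz] at h1
  have hne : (torusPow t u : ℂ) * star (torusPow t v : ℂ) ≠ 1 := by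
    intro h2
    refine ht (Circle.ext ?_)
    have h3 : (torusPow t v : ℂ) * star (torusPow t v : ℂ) = 1 := by
      rw [Complex.star_def, Complex.mul_conj, Circle.normSq_coe, Complex.ofReal_one]
    exact mul_right_cancel₀ (right_ne_zero_of_mul_eq_one h3) (h2.trans h3.symm)
  have h4 : ((torusPow t u : ℂ) * star (torusPow t v : ℂ) - 1) •
      (expectation θ a : GraphAlgebra θ) = 0 := by
    rw [sub_smul, one_smul, h1, sub_self]
  exact (smul_eq_zero.1 h4).resolve_left (sub_ne_zero.2 hne)

lemma gauge_s_mul_star_s (t : Circle × Circle) (u v : Words θ) :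
    gauge θ t (s u * star (s v)) =
      ((torusPow t u : ℂ) * star (torusPow t v : ℂ)) • (s u * star (s v)) := by
  rw [map_mul, map_star, gauge_s, gauge_s, star_smul, smul_mul_smul_comm]

lemma expectation_gauge (t : Circle × Circle) (a : GraphAlgebra θ) :
    expectation θ (gauge θ t a) = expectation θ a := by
  obtain ⟨y, rfl⟩ := exists_torusPoint t
  refine Subtype.ext ?_
  rw [coe_expectation, coe_expectation]
  simp_rw [← gauge_mul, ← torusPoint_add]
  have : (MeasureTheory.volume : MeasureTheory.Measure
      (UnitAddCircle × UnitAddCircle)).IsAddLeftInvariant :=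
    MeasureTheory.Measure.prod.instIsAddLeftInvariant
  exact MeasureTheory.integral_add_right_eq_self (fun x => gauge θ (torusPoint x) a) y

/-- The expectation of a positive element is of the form `y^* y` with `y ∈ 𝔉`. -/
lemma exists_expectation_star_mul_self_eq (a : GraphAlgebra θ) :
    ∃ y : gaugeFixed θ, expectation θ (star a * a) = star y * y := by
  let _ := CStarAlgebra.spectralOrder (GraphAlgebra θ)
  have _ := CStarAlgebra.spectralOrderedRing (GraphAlgebra θ)
  set p := expectation θ (star a * a) with hp
  have hp0 : 0 ≤ (p : GraphAlgebra θ) := by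
    rw [hp, coe_expectation]
    refine MeasureTheory.integral_nonneg fun x => ?_
    simp only [Pi.zero_apply, map_mul, map_star]
    exact star_mul_self_nonneg _
  have hq0 := CFC.sqrt_nonneg (p : GraphAlgebra θ)
  -- Uniqueness of positive square roots makes the root gauge invariant, so positivity of `τ` on `𝔉`
  -- becomes applicable.
  have hfix : ∀ t, gauge θ t (CFC.sqrt (p : GraphAlgebra θ)) = CFC.sqrt (p : GraphAlgebra θ) := by
    intro t
    refine (CFC.sqrt_unique ?_ ?_).symm
    · rw [← map_mul, CFC.sqrt_mul_sqrt_self _ hp0, p.2 t]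
    · exact map_nonneg (gauge θ t) hq0
  refine ⟨⟨_, hfix⟩, Subtype.ext ?_⟩
  change (p : GraphAlgebra θ) = star (CFC.sqrt (p : GraphAlgebra θ)) * CFC.sqrt (p : GraphAlgebra θ)
  rw [(IsSelfAdjoint.of_nonneg hq0).star_eq, CFC.sqrt_mul_sqrt_self _ hp0]

lemma _root_.IsState.inducedFunctional {τ : gaugeFixed θ →L[ℂ] ℂ} (hτ : IsState τ) :
    IsState (inducedFunctional τ) where
  map_one := by
    change τ (expectation θ ((1 : gaugeFixed θ) : GraphAlgebra θ)) = 1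
    rw [expectation_coe, hτ.map_one]
  nonneg a := by
    obtain ⟨y, hy⟩ := exists_expectation_star_mul_self_eq a
    change 0 ≤ τ (expectation θ (star a * a))
    rw [hy]
    exact hτ.nonneg y

/-! ### Tracial states of the gauge fixed point algebra -/

/-- The map `x ↦ s_u x s_v^*` of `𝔉` for words `u`, `v` of the same degree. -/
def sandwich (u v : Words θ) (h : degree u = degree v) : gaugeFixed θ →L[ℂ] gaugeFixed θ where
  toFun x := ⟨s u * x * star (s v), fun t => by
    rw [map_mul, map_mul, map_star, gauge_s, gauge_s, x.2 t, torusPow_eq h, smul_mul_assoc,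
      torusPow_smul_mul_star]⟩
  map_add' x y := Subtype.ext (by simp [mul_add, add_mul])
  map_smul' r x := Subtype.ext (by simp)
  cont := Continuous.subtype_mk (by fun_prop) _

lemma coe_sandwich (u v : Words θ) (h : degree u = degree v) (x : gaugeFixed θ) :
    (sandwich u v h x : GraphAlgebra θ) = s u * x * star (s v) := rfl

/-- Sandwiches multiply like matrix units with coefficients in `𝔉`; the inner words cancel because
`s_v` is an isometry. -/
lemma sandwich_mul_sandwich {u v w : Words θ} (h : degree u = degree v) (h' : degree v = degree w)
    (x y : gaugeFixed θ) :
    sandwich u v h x * sandwich v w h' y = sandwich u w (h.trans h') (x * y) := by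
  refine Subtype.ext ?_
  change s u * x * star (s v) * (s v * y * star (s w)) = s u * (x * y) * star (s w)
  calc _ = s u * x * (star (s v) * s v) * y * star (s w) := by noncomm_ring
    _ = _ := by rw [star_s_mul_s]; noncomm_ring

lemma sandwich_mul_sandwich_eq_zero {u v w z : Words θ} (h : degree u = degree v)
    (h' : degree w = degree z) (hvw : star (s v) * s w = 0) (x y : gaugeFixed θ) :
    sandwich u v h x * sandwich w z h' y = 0 := by
  refine Subtype.ext ?_
  change s u * x * star (s v) * (s w * y * star (s z)) = 0
  calc _ = s u * x * (star (s v) * s w) * y * star (s z) := by noncomm_ring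
    _ = _ := by rw [hvw]; noncomm_ring

lemma star_sandwich (u v : Words θ) (h : degree u = degree v) (x : gaugeFixed θ) :
    star (sandwich u v h x) = sandwich v u h.symm (star x) := by
  refine Subtype.ext ?_
  change star (s u * x * star (s v)) = s v * star (x : GraphAlgebra θ) * star (s u)
  rw [star_mul, star_mul, star_star, mul_assoc]

lemma sandwich_sandwich {u v u' v' : Words θ} (h : degree u = degree v) (h' : degree u' = degree v')
    (x : gaugeFixed θ) : sandwich u v h (sandwich u' v' h' x) =
      sandwich (u * u') (v * v') (by rw [degree_mul, degree_mul, h, h']) x := by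
  refine Subtype.ext ?_
  simp only [coe_sandwich, s_mul, star_mul]
  noncomm_ring

variable {τ : gaugeFixed θ →L[ℂ] ℂ}

/-- The partial isometry `s_u s_v^*` lies in `𝔉` and carries one corner to the other, so cyclicity
identifies the two values. -/
lemma _root_.IsTracialState.sandwich_self (hτ : IsTracialState τ) {u v : Words θ}
    (h : degree u = degree v) (x : gaugeFixed θ) :
    τ (sandwich u u rfl x) = τ (sandwich v v rfl x) := by
  rw [← one_mul x, ← sandwich_mul_sandwich h h.symm, hτ.trace, sandwich_mul_sandwich, mul_one,
    one_mul]

/-- Split off `s_u s_u^*` on the left; after a cyclic swap the product contains `s_v^* s_u = 0`. -/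
lemma _root_.IsTracialState.sandwich_eq_zero (hτ : IsTracialState τ) {u v : Words θ}
    (h : degree u = degree v) (hvu : star (s v) * s u = 0) (x : gaugeFixed θ) :
    τ (sandwich u v h x) = 0 := by
  rw [← one_mul x, ← sandwich_mul_sandwich rfl h, hτ.trace, sandwich_mul_sandwich_eq_zero _ _ hvu,
    map_zero]

variable {k : ℕ} {g : Fin k → Words θ}

/-- Shifting a tracial state by the endomorphism `x ↦ ∑ s_{g_i} x s_{g_i}^*`. -/
lemma _root_.IsTracialState.sum_sandwich (hτ : IsTracialState τ)
    (hsum : ∑ i, s (g i) * star (s (g i)) = 1) :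
    IsTracialState (∑ i, τ.comp (sandwich (g i) (g i) rfl)) where
  map_one := by
    rw [← hτ.map_one, sum_apply]
    simp only [ContinuousLinearMap.comp_apply]
    rw [← map_sum]
    congr 1
    refine Subtype.ext ?_
    rw [AddSubmonoidClass.coe_finsetSum]
    simpa [coe_sandwich] using hsum
  nonneg x := by
    simp only [sum_apply, ContinuousLinearMap.comp_apply]
    refine Finset.sum_nonneg fun i _ => ?_
    rw [← sandwich_mul_sandwich rfl rfl, ← star_sandwich]
    exact hτ.nonneg _
  trace x y := by
    simp only [sum_apply, ContinuousLinearMap.comp_apply]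
    refine Finset.sum_congr rfl fun i _ => ?_
    rw [← sandwich_mul_sandwich rfl rfl, hτ.trace, sandwich_mul_sandwich]

lemma _root_.IsTracialState.natCast_mul_sandwich (hτ : IsTracialState τ)
    (hg : ∀ i j, degree (g i) = degree (g j)) (i : Fin k) (x : gaugeFixed θ) :
    (k : ℂ) * τ (sandwich (g i) (g i) rfl x) = (∑ i, τ.comp (sandwich (g i) (g i) rfl)) x := by
  simp only [sum_apply, ContinuousLinearMap.comp_apply]
  rw [Finset.sum_congr rfl fun j _ => hτ.sandwich_self (hg j i) x]
  simp

/-! ### Uniqueness of the trace on `𝔉` -/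

lemma eq_one_of_degree_eq_zero {w : Words θ} (h : degree w = 0) : w = 1 := by
  induction w using word_induction with
  | one => rfl
  | he i w _ => simp [Prod.ext_iff] at h
  | hf j w _ => simp [Prod.ext_iff] at h

/-- Removal of one letter from each word. For `i = j` the value is `1/k` times that of the shifted
trace, so `ih` is needed for all pairs of traces: it is applied to the shifts of `τ` and `τ'`. -/
lemma _root_.IsTracialState.eq_sandwich_mul {τ' : gaugeFixed θ →L[ℂ] ℂ}
    (hτ : IsTracialState τ) (hτ' : IsTracialState τ')
    (hg : ∀ i j, degree (g i) = degree (g j)) (hsum : ∑ i, s (g i) * star (s (g i)) = 1)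
    {u v : Words θ} (huv : degree u = degree v)
    (ih : ∀ τ τ' : gaugeFixed θ →L[ℂ] ℂ, IsTracialState τ → IsTracialState τ' →
      τ (sandwich u v huv 1) = τ' (sandwich u v huv 1)) (i j : Fin k) (h) :
    τ (sandwich (g i * u) (g j * v) h 1) = τ' (sandwich (g i * u) (g j * v) h 1) := by
  rw [← sandwich_sandwich (hg i j) huv]
  by_cases hij : i = j
  · subst hij
    have hk : (k : ℂ) ≠ 0 := Nat.cast_ne_zero.2 i.pos.ne'
    refine mul_left_cancel₀ hk ?_
    rw [hτ.natCast_mul_sandwich hg, hτ'.natCast_mul_sandwich hg]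
    exact ih _ _ (hτ.sum_sandwich hsum) (hτ'.sum_sandwich hsum)
  · have h0 := star_mul_eq_zero_of_sum_mul_star_eq_one (fun i => star_s_mul_s (g i)) hsum
      (Ne.symm hij)
    rw [hτ.sandwich_eq_zero _ h0, hτ'.sandwich_eq_zero _ h0]

/-- Equality of degrees lets `v` be rewritten to start with a letter of the same kind as `u`, so
both words shrink together. -/
lemma sandwich_one_eq (u : Words θ) : ∀ (v : Words θ) (h : degree u = degree v)
    (τ τ' : gaugeFixed θ →L[ℂ] ℂ), IsTracialState τ → IsTracialState τ' →
      τ (sandwich u v h 1) = τ' (sandwich u v h 1) := by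
  induction u using word_induction with
  | one =>
    intro v h τ τ' hτ hτ'
    obtain rfl := eq_one_of_degree_eq_zero (h.symm.trans degree_one)
    have : sandwich (1 : Words θ) 1 h 1 = 1 := Subtype.ext (by simp [coe_sandwich, s_one])
    rw [this, hτ.map_one, hτ'.map_one]
  | he i u ih =>
    intro v h τ τ' hτ hτ'
    obtain ⟨j, v, rfl⟩ := exists_eq_e_mul v (by simp [← h])
    have huv : degree u = degree v := by simpa using h
    exact hτ.eq_sandwich_mul hτ' (fun _ _ => rfl) sum_s_e huv (ih v huv) i j h
  | hf i u ih =>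
    intro v h τ τ' hτ hτ'
    obtain ⟨j, v, rfl⟩ := exists_eq_f_mul v (by simp [← h])
    have huv : degree u = degree v := by simpa using h
    exact hτ.eq_sandwich_mul hτ' (fun _ _ => rfl) sum_s_f huv (ih v huv) i j h

/-- The gauge fixed point algebra has at most one tracial state. -/
theorem _root_.IsTracialState.eq {τ' : gaugeFixed θ →L[ℂ] ℂ} (hτ : IsTracialState τ)
    (hτ' : IsTracialState τ') : τ = τ' := by
  -- Comparing `τ ∘ Φ` with `τ' ∘ Φ` uses the dense span in `O_θ`: `Φ` kills the terms of unequal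
  -- degree and fixes the others.
  have h : inducedFunctional τ = inducedFunctional τ' := by
    refine clm_ext fun u v => ?_
    change τ (expectation θ _) = τ' (expectation θ _)
    by_cases huv : degree u = degree v
    · have h1 : s u * star (s v) = (sandwich u v huv 1 : GraphAlgebra θ) := by
        simp [coe_sandwich]
      rw [h1, expectation_coe]
      exact sandwich_one_eq u v huv τ τ' hτ hτ'
    · rw [expectation_eq_zero huv fun t => gauge_s_mul_star_s t u v, map_zero, map_zero]
  ext x
  have := DFunLike.congr_fun h (x : GraphAlgebra θ)
  change τ (expectation θ (x : GraphAlgebra θ)) = τ' (expectation θ (x : GraphAlgebra θ)) at this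
  rwa [expectation_coe] at this

/-! ### The state induced by the trace -/

section Induced

variable {τ : gaugeFixed θ →L[ℂ] ℂ} {k : ℕ} {g : Fin k → Words θ}

lemma torusPow_mul (t : Circle × Circle) (u v : Words θ) :
    torusPow t (u * v) = torusPow t u * torusPow t v := by
  simp only [torusPow, degree_mul, Prod.fst_add, Prod.snd_add, pow_add]
  ac_rfl

lemma inducedFunctional_coe (x : gaugeFixed θ) :
    inducedFunctional τ (x : GraphAlgebra θ) = τ x :=
  congrArg τ (expectation_coe x)

lemma inducedFunctional_eq_zero {a : GraphAlgebra θ} {u v : Words θ} (huv : degree u ≠ degree v)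
    (h : ∀ t, gauge θ t a = ((torusPow t u : ℂ) * star (torusPow t v : ℂ)) • a) :
    inducedFunctional τ a = 0 :=
  (congrArg τ (expectation_eq_zero huv h)).trans (map_zero τ)

lemma inducedFunctional_gauge (t : Circle × Circle) (a : GraphAlgebra θ) :
    inducedFunctional τ (gauge θ t a) = inducedFunctional τ a :=
  congrArg τ (expectation_gauge t a)

/-- Let `g = g i`. If `y = s_g b` is in `𝔉`, then `τ(y) = τ(s_g s_g^* y) = τ(y s_g s_g^*) = τ(s_g (b
s_g) s_g^*)`, and `k` times this is the shifted trace of `b s_g`. By uniqueness the shifted trace is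
`τ`. For `b = s_u s_v^*` with `y` outside `𝔉`, both sides vanish under `Φ`. -/
lemma _root_.IsTracialState.natCast_mul_induced (hτ : IsTracialState τ)
    (hg : ∀ i j, degree (g i) = degree (g j)) (hsum : ∑ i, s (g i) * star (s (g i)) = 1)
    (i : Fin k) (b : GraphAlgebra θ) :
    (k : ℂ) * inducedFunctional τ (s (g i) * b) = inducedFunctional τ (b * s (g i)) := by
  refine DFunLike.congr_fun (clm_ext (φ := (k : ℂ) • (inducedFunctional τ).comp
    (ContinuousLinearMap.mul ℂ (GraphAlgebra θ) (s (g i)))) (ψ := (inducedFunctional τ).comp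
    ((ContinuousLinearMap.mul ℂ (GraphAlgebra θ)).flip (s (g i)))) fun u v => ?_) b
  change (k : ℂ) * inducedFunctional τ (s (g i) * (s u * star (s v))) =
    inducedFunctional τ (s u * star (s v) * s (g i))
  have hgauge : ∀ t, gauge θ t (s u * star (s v) * s (g i)) =
      ((torusPow t (g i * u) : ℂ) * star (torusPow t v : ℂ)) • (s u * star (s v) * s (g i)) := by
    intro t
    rw [map_mul, gauge_s_mul_star_s, gauge_s, smul_mul_smul_comm, torusPow_mul, Circle.coe_mul]
    congr 1
    ring
  rw [← mul_assoc (s (g i)), ← s_mul]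
  by_cases huv : degree (g i * u) = degree v
  · let x : gaugeFixed θ := ⟨s u * star (s v) * s (g i), fun t => by
      rw [hgauge, torusPow_eq huv, Complex.star_def, Complex.mul_conj, Circle.normSq_coe,
        Complex.ofReal_one, one_smul]⟩
    have h1 : s (g i * u) * star (s v) = (sandwich (g i * u) v huv 1 : GraphAlgebra θ) := by
      simp [coe_sandwich]
    have h2 : sandwich (g i * u) v huv 1 * sandwich (g i) (g i) rfl 1 =
        sandwich (g i) (g i) rfl x := by
      refine Subtype.ext ?_
      simp only [MulMemClass.coe_mul, coe_sandwich, x, s_mul, OneMemClass.coe_one, mul_one]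
      noncomm_ring
    have h3 : sandwich (g i) (g i) rfl 1 * sandwich (g i * u) v huv 1 =
        sandwich (g i * u) v huv 1 := by
      refine Subtype.ext ?_
      simp only [MulMemClass.coe_mul, coe_sandwich, s_mul, OneMemClass.coe_one, mul_one]
      calc _ = s (g i) * (star (s (g i)) * s (g i)) * s u * star (s v) := by noncomm_ring
        _ = _ := by rw [star_s_mul_s, mul_one]
    change _ = inducedFunctional τ (x : GraphAlgebra θ)
    rw [h1, inducedFunctional_coe, inducedFunctional_coe, ← h3, hτ.trace, h2,
      hτ.natCast_mul_sandwich hg, (hτ.sum_sandwich hsum).eq hτ]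
  · rw [inducedFunctional_eq_zero huv fun t => gauge_s_mul_star_s t _ v,
      inducedFunctional_eq_zero huv hgauge, mul_zero]

/-- Insert `∑ s_{g_j} s_{g_j}^*` before `b s_{g_i}^*` and move each `s_{g_j}` to the right end,
where `s_{g_i}^* s_{g_j}` leaves only `j = i`. -/
lemma _root_.IsTracialState.induced_star_mul (hτ : IsTracialState τ)
    (hg : ∀ i j, degree (g i) = degree (g j)) (hsum : ∑ i, s (g i) * star (s (g i)) = 1)
    (i : Fin k) (b : GraphAlgebra θ) :
    inducedFunctional τ (star (s (g i)) * b) =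
      (k : ℂ) * inducedFunctional τ (b * star (s (g i))) := by
  have h1 : b * star (s (g i)) = ∑ j, s (g j) * (star (s (g j)) * (b * star (s (g i)))) := by
    simp_rw [← mul_assoc (s (g _))]
    rw [← Finset.sum_mul, hsum, one_mul]
  rw [h1, map_sum, Finset.mul_sum]
  simp_rw [hτ.natCast_mul_induced hg hsum]
  rw [Finset.sum_eq_single i]
  · rw [mul_assoc, mul_assoc, star_s_mul_s, mul_one]
  · intro j _ hj
    rw [mul_assoc, mul_assoc, star_mul_eq_zero_of_sum_mul_star_eq_one
      (fun i => star_s_mul_s (g i)) hsum hj.symm, mul_zero, mul_zero, map_zero]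
  · simp

/-- The number `m ^ k * n ^ l` of words of degree `d(w) = (k, l)`. -/
def weight (w : Words θ) : ℂ := (m : ℂ) ^ (degree w).1 * (n : ℂ) ^ (degree w).2

lemma _root_.IsTracialState.weight_mul_induced (hτ : IsTracialState τ) (w : Words θ) :
    ∀ b, weight w * inducedFunctional τ (s w * b) = inducedFunctional τ (b * s w) := by
  induction w using word_induction with
  | one => simp [weight, s_one]
  | he i w ih =>
    intro b
    have hw : weight (e θ i * w) = weight w * m := by simp [weight, pow_add]; ring
    rw [hw, s_mul, mul_assoc, mul_assoc, hτ.natCast_mul_induced (g := e θ) (fun _ _ => rfl) sum_s_e,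
      mul_assoc, ih, mul_assoc]
  | hf j w ih =>
    intro b
    have hw : weight (f θ j * w) = weight w * n := by simp [weight, pow_add]; ring
    rw [hw, s_mul, mul_assoc, mul_assoc, hτ.natCast_mul_induced (g := f θ) (fun _ _ => rfl) sum_s_f,
      mul_assoc, ih, mul_assoc]

lemma _root_.IsTracialState.induced_star_s_mul (hτ : IsTracialState τ) (w : Words θ) :
    ∀ b, inducedFunctional τ (star (s w) * b) =
      weight w * inducedFunctional τ (b * star (s w)) := by
  induction w using word_induction with
  | one => simp [weight, s_one]
  | he i w ih =>
    intro b
    have hw : weight (e θ i * w) = weight w * m := by simp [weight, pow_add]; ring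
    rw [hw, s_mul, star_mul, mul_assoc, ih, mul_assoc,
      hτ.induced_star_mul (g := e θ) (fun _ _ => rfl) sum_s_e, mul_assoc, mul_assoc]
  | hf j w ih =>
    intro b
    have hw : weight (f θ j * w) = weight w * n := by simp [weight, pow_add]; ring
    rw [hw, s_mul, star_mul, mul_assoc, ih, mul_assoc,
      hτ.induced_star_mul (g := f θ) (fun _ _ => rfl) sum_s_f, mul_assoc, mul_assoc]

/-- The KMS identity for the eigenvector `s_u s_v^*`, with the eigenvalue of `σ_{-i}` written as
`weight v / weight u`. -/
lemma _root_.IsTracialState.weight_mul_induced_mul (hτ : IsTracialState τ) (u v : Words θ)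
    (b : GraphAlgebra θ) :
    weight u * inducedFunctional τ (s u * star (s v) * b) =
      weight v * inducedFunctional τ (b * (s u * star (s v))) := by
  rw [mul_assoc (s u), hτ.weight_mul_induced, mul_assoc, hτ.induced_star_s_mul, mul_assoc]

end Induced

/-! ### The KMS condition -/

/-- The real number `μ` with `σ_t(s_u s_v^*) = e^{iμt} s_u s_v^*`. -/
def frequency (u v : Words θ) : ℝ :=
  (((degree v).1 : ℝ) - (degree u).1) * Real.log m + (((degree v).2 : ℝ) - (degree u).2) * Real.log n

lemma modular_s_mul_star_s (t : ℝ) (u v : Words θ) : modular θ t (s u * star (s v)) =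
    Complex.exp (Complex.I * t * frequency u v) • (s u * star (s v)) := by
  rw [modular_apply, frequency]
  push_cast
  rfl

lemma weight_eq_exp (hm : m ≠ 0) (hn : n ≠ 0) (w : Words θ) : weight w =
    Complex.exp ((degree w).1 * Real.log m + (degree w).2 * Real.log n) := by
  have h : ∀ k : ℕ, k ≠ 0 → Complex.exp (Real.log k : ℝ) = k := fun k hk => by
    rw [← Complex.ofReal_exp, Real.exp_log (by positivity), Complex.ofReal_natCast]
  rw [Complex.exp_add, Complex.exp_nat_mul, Complex.exp_nat_mul, h m hm, h n hn, weight]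

lemma weight_eq_exp_mul (hm : m ≠ 0) (hn : n ≠ 0) (u v : Words θ) :
    weight v = Complex.exp (frequency u v) * weight u := by
  rw [weight_eq_exp hm hn, weight_eq_exp hm hn, ← Complex.exp_add, frequency]
  congr 1
  push_cast
  ring

/-- Two entire functions that agree on the real line are equal. -/
lemma eq_of_differentiable_of_eq_ofReal {G H : ℂ → ℂ} (hG : Differentiable ℂ G)
    (hH : Differentiable ℂ H) (h : ∀ t : ℝ, G t = H t) : G = H := by
  refine AnalyticOnNhd.eq_of_frequently_eq (z₀ := ((0 : ℝ) : ℂ)) (fun z _ => hG.analyticAt z)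
    (fun z _ => hH.analyticAt z) ?_
  have ht : Filter.Tendsto (fun t : ℝ => (t : ℂ)) (nhdsWithin 0 {0}ᶜ)
      (nhdsWithin ((0 : ℝ) : ℂ) {((0 : ℝ) : ℂ)}ᶜ) :=
    Complex.continuous_ofReal.continuousWithinAt.tendsto_nhdsWithin fun t ht => by simpa using ht
  exact ht.frequently (Filter.Eventually.frequently (Filter.Eventually.of_forall h))

/-- With no letters of one kind, the empty sum of range projections forces `1 = 0`, and a zero
algebra has no state. -/
lemma _root_.IsTracialState.ne_zero {τ : gaugeFixed θ →L[ℂ] ℂ} (hτ : IsTracialState τ) :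
    m ≠ 0 ∧ n ≠ 0 := by
  have h01 : (1 : GraphAlgebra θ) ≠ 0 := fun h => by
    have h1 : (1 : gaugeFixed θ) = 0 := Subtype.ext h
    have := hτ.map_one
    rw [h1, map_zero] at this
    exact zero_ne_one this
  constructor
  · rintro rfl
    exact h01 (by rw [← sum_s_e]; simp)
  · rintro rfl
    exact h01 (by rw [← sum_s_f]; simp)

/-- A tracial state on `𝔉` induces a KMS state on `O_θ`. -/
theorem _root_.IsTracialState.isKMSState_inducedFunctional {τ : gaugeFixed θ →L[ℂ] ℂ}
    (hτ : IsTracialState τ) : IsKMSState (modular θ) (-1) (inducedFunctional τ) where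
  isState := hτ.toIsState.inducedFunctional
  kms a b F hF _ := by
    obtain ⟨hm, hn⟩ := hτ.ne_zero
    -- Both sides are continuous in `b`, so `b` may be taken to be `s_u s_v^*` while `a` stays an
    -- arbitrary entire element; no approximation of `a` is needed.
    refine DFunLike.congr_fun (clm_ext (φ := (inducedFunctional τ).comp
      (ContinuousLinearMap.mul ℂ (GraphAlgebra θ) a)) (ψ := (inducedFunctional τ).comp
      ((ContinuousLinearMap.mul ℂ (GraphAlgebra θ)).flip (F (Complex.I * (-1 : ℝ)))))
      fun u v => ?_) b
    change inducedFunctional τ (a * (s u * star (s v))) =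
      inducedFunctional τ (s u * star (s v) * F (Complex.I * (-1 : ℝ)))
    -- For real `z`, invariance of `ω` under `σ` transfers the flow from `a` to the eigenvector `s_u
    -- s_v^*`; the identity theorem extends this to `z = -i`.
    have key : (fun z => inducedFunctional τ (s u * star (s v) * F z)) = fun z =>
        Complex.exp (-(Complex.I * z * frequency u v)) *
          inducedFunctional τ (s u * star (s v) * a) := by
      refine eq_of_differentiable_of_eq_ofReal ?_ (by fun_prop) fun t => ?_
      · exact (inducedFunctional τ).differentiable.comp (hF.differentiable.const_mul _)
      · rw [hF.eq_real, ← inducedFunctional_gauge _ (s u * star (s v) * a)]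
        change _ = _ * inducedFunctional τ (modular θ t _)
        rw [map_mul (modular θ t), modular_s_mul_star_s, smul_mul_assoc, map_smul, smul_eq_mul,
          ← mul_assoc, ← Complex.exp_add, neg_add_cancel, Complex.exp_zero, one_mul]
    have h1 := congrFun key (Complex.I * (-1 : ℝ))
    have h2 : -(Complex.I * (Complex.I * (-1 : ℝ)) * frequency u v) = -(frequency u v : ℂ) := by
      rw [← mul_assoc, Complex.I_mul_I]
      push_cast
      ring
    have hv : weight v ≠ 0 := by
      rw [weight_eq_exp hm hn]
      exact Complex.exp_ne_zero _
    rw [h1, h2]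
    refine mul_left_cancel₀ hv ?_
    have hexp : Complex.exp (frequency u v) * Complex.exp (-(frequency u v : ℂ)) = 1 := by
      rw [← Complex.exp_add, add_neg_cancel, Complex.exp_zero]
    rw [← hτ.weight_mul_induced_mul, weight_eq_exp_mul hm hn u v]
    linear_combination
      (-(weight u * inducedFunctional τ (s u * star (s v) * a))) * hexp

/-! ### Uniqueness of the KMS state by restriction to `O_θ^σ` -/

lemma isEntireExtension_const {a : GraphAlgebra θ} (ha : a ∈ modularFixed θ) :
    IsEntireExtension (modular θ) a fun _ => a where
  differentiable := differentiable_const _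
  eq_real t := (ha t).symm

/-- The inclusion of the fixed point algebra of the modular action. -/
def modularFixedSubtype (θ : Equiv.Perm (Fin m × Fin n)) :
    modularFixed θ →L[ℂ] GraphAlgebra θ where
  toFun := Subtype.val
  map_add' _ _ := rfl
  map_smul' _ _ := rfl
  cont := continuous_subtype_val

/-- The inclusion of the gauge fixed point algebra into the fixed point algebra of the modular
action. -/
def gaugeFixedInclusion (θ : Equiv.Perm (Fin m × Fin n)) : gaugeFixed θ →L[ℂ] modularFixed θ where
  toFun x := ⟨x, fun _ => x.2 _⟩
  map_add' _ _ := rfl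
  map_smul' _ _ := rfl
  cont := Continuous.subtype_mk continuous_subtype_val _

lemma _root_.IsTracialState.comp_gaugeFixedInclusion {ψ : modularFixed θ →L[ℂ] ℂ}
    (hψ : IsTracialState ψ) : IsTracialState (ψ.comp (gaugeFixedInclusion θ)) where
  map_one := hψ.map_one
  nonneg x := hψ.nonneg (gaugeFixedInclusion θ x)
  trace x y := hψ.trace (gaugeFixedInclusion θ x) (gaugeFixedInclusion θ y)

variable {φ : GraphAlgebra θ →L[ℂ] ℂ} {β : ℝ}

/-- KMS states restrict to traces on the fixed point algebra. -/
lemma _root_.IsKMSState.isTracialState_comp (hφ : IsKMSState (modular θ) β φ) :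
    IsTracialState (φ.comp (modularFixedSubtype θ)) where
  map_one := hφ.isState.map_one
  nonneg x := hφ.isState.nonneg x
  trace x y := hφ.kms x y _ (isEntireExtension_const x.2) ⟨_, isEntireExtension_const y.2⟩

/-- The KMS condition against `1` gives `φ(x) = e^μ φ(x)` for `x = s_u s_v^*`, and `e^μ ≠ 1` for
real `μ ≠ 0`. -/
lemma _root_.IsKMSState.apply_eq_zero (hφ : IsKMSState (modular θ) (-1) φ) {u v : Words θ}
    (huv : frequency u v ≠ 0) : φ (s u * star (s v)) = 0 := by
  have hF : IsEntireExtension (modular θ) (s u * star (s v))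
      fun z => Complex.exp (Complex.I * z * frequency u v) • (s u * star (s v)) :=
    ⟨by fun_prop, fun t => (modular_s_mul_star_s t u v).symm⟩
  have h := hφ.kms _ 1 _ hF ⟨_, isEntireExtension_const (one_mem _)⟩
  have h2 : Complex.I * (Complex.I * (-1 : ℝ)) * frequency u v = (frequency u v : ℂ) := by
    rw [← mul_assoc, Complex.I_mul_I]
    push_cast
    ring
  rw [mul_one, one_mul, map_smul, h2, smul_eq_mul] at h
  by_contra h0
  have h3 : Complex.exp (frequency u v : ℂ) = 1 := (right_eq_mul₀ h0).1 h
  rw [← Complex.ofReal_exp, Complex.ofReal_eq_one, Real.exp_eq_one_iff] at h3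
  exact huv h3

end RankTwoGraph

end

theorem proposition4p5 (m n : ℕ) (θ : Equiv.Perm (Fin m × Fin n))
    (h : ∃! ψ : RankTwoGraph.modularFixed θ →L[ℂ] ℂ, IsTracialState ψ) :
    ∃ τ : RankTwoGraph.gaugeFixed θ →L[ℂ] ℂ,
      (IsTracialState τ ∧ ∀ τ' : RankTwoGraph.gaugeFixed θ →L[ℂ] ℂ, IsTracialState τ' → τ' = τ) ∧
      IsKMSState (RankTwoGraph.modular θ) (-1) (RankTwoGraph.inducedFunctional τ) ∧
      ∀ φ : RankTwoGraph.GraphAlgebra θ →L[ℂ] ℂ,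
        IsKMSState (RankTwoGraph.modular θ) (-1) φ → φ = RankTwoGraph.inducedFunctional τ := by
  obtain ⟨ψ, hψ, hψu⟩ := h
  have hτ := hψ.comp_gaugeFixedInclusion
  have hω := hτ.isKMSState_inducedFunctional
  refine ⟨_, ⟨hτ, fun τ' hτ' => hτ'.eq hτ⟩, hω, fun φ hφ => RankTwoGraph.clm_ext fun u v => ?_⟩
  -- Frequency zero does not force equal degrees when `log m` and `log n` are rationally dependent.
  -- Such terms lie in `O_θ^σ` but may lie outside `𝔉`, so uniqueness of the trace on the larger
  -- algebra is used.
  by_cases huv : RankTwoGraph.frequency u v = 0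
  · have hmem : RankTwoGraph.s u * star (RankTwoGraph.s v) ∈ RankTwoGraph.modularFixed θ :=
      fun t => by simp [RankTwoGraph.modular_s_mul_star_s, huv]
    exact DFunLike.congr_fun ((hψu _ hφ.isTracialState_comp).trans
      (hψu _ hω.isTracialState_comp).symm) ⟨_, hmem⟩
  · rw [hφ.apply_eq_zero huv, hω.apply_eq_zero huv]
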